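/- Write a permutation of $[n]=\{1,\dots,n\}$ in one-line notation as a word $\pi=\pi(1)\pi(2)\cdots\pi(n)$. Let $\mathbf S$ be Knuth's stack-sorting operator, defined on words with distinct entries by $\mathbf S(\varepsilon)=\varepsilon$ and $\mathbf S(\alpha m\beta)=\mathbf S(\alpha)\,\mathbf S(\beta)\,m$, where $m$ is the largest entry of $\alpha m\beta$, and let $\mathbf R$ be the reversal of words. A permutation $\theta$ of $[n]$ is sorted by an operator $\mathbf B$ if $\mathbf B(\theta)=12\cdots n$. The permutations sorted by $\mathbf S$ are exactly those avoiding the pattern $231$. For permutations $\alpha$ of $[a]$ and $\beta$ of $[b]$ put $\alpha\oplus\beta=\alpha(\beta+a)$ and $\alpha\ominus\beta=(\alpha+b)\beta$. Every nonempty permutation avoiding $231$ is uniquely of the form $\alpha\oplus(1\ominus\beta)$ with $\alpha,\beta$ (possibly empty) avoiding $231$; define $P$ on permutations avoiding $231$ recursively by $P(\varepsilon)=\varepsilon$ and $P(\alpha\oplus(1\ominus\beta))=(P(\alpha)\oplus 1)\ominus P(\beta)$. For $\pi$ avoiding $231$, let $\lambda_\pi$ be the permutation with $P(\pi)=\lambda_\pi\circ\pi$.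 For an operator $\mathbf A$ and $\theta$ sorted by $\mathbf S\circ\mathbf A$, put $\Phi_{\mathbf A}(\theta)=\lambda_{\mathbf A(\theta)}\circ\theta$. **Theorem.** Let $\mathbf A$ be any (possibly empty) composition of the operators $\mathbf S$ and $\mathbf R$, and let $n\ge 0$. Let $X$ and $Y$ be the sets of permutations of $[n]$ sorted by $\mathbf S\circ\mathbf A$ and by $\mathbf S\circ\mathbf R\circ\mathbf A$, respectively. Then $|X|=|Y|$; more precisely, $\Phi_{\mathbf A}$ is a bijection from $X$ to $Y$. Moreover, each of the following statistics is preserved by $\Phi_{\mathbf A}$, and hence equidistributed across $X$ and $Y$: 1. the number and the set of positions of the right-to-left maxima (the $i$ with $\pi(j)<\pi(i)$ for all $j>i$); 2. the number and the set of positions of the left-to-right maxima (the $i$ with $\pi(j)<\pi(i)$ for all $j<i$); 3. the up-down word $w_\pi\in\{u,d\}^{n-1}$ (the empty word if $n=0$), where $w_\pi(i)=u$ if $\pi(i)<\pi(i+1)$ and $w_\pi(i)=d$ if $\pi(i)>\pi(i+1)$, and hence every statistic of permutations of $[n]$ that is determined by the up-down word; 4. if $\mathbf A=\mathbf A_0\circ\mathbf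 S$ for some composition $\mathbf A_0$ of $\mathbf S$ and $\mathbf R$: the statistic $\mathrm{zeil}(\pi)=\max\{k\le n : n(n-1)\cdots(n-k+1)\text{ is a (not necessarily contiguous) subword of }\pi\}$; 5. if $\mathbf A=\mathbf B_0\circ\mathbf S\circ\mathbf R\circ\mathbf S^k$ for some composition $\mathbf B_0$ of $\mathbf S$ and $\mathbf R$ and some $k\ge1$: the statistic $\mathrm{Rzeil}(\pi)=\max\{j\le n : (n-j+1)\cdots(n-1)n\text{ is a (not necessarily contiguous) subword of }\pi\}$. -/

import Mathlib

namespace StackSorting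

/-! Permutations are handled in one-line notation: the permutation `π` of `[n] = {1, …, n}` is the
word `π(1) π(2) … π(n)`, a list of natural numbers. -/

/-- `w` is the one-line notation of a permutation of `{1, …, n}`. -/
def IsPermutation (n : ℕ) (w : List ℕ) : Prop :=
  w.Perm (List.range' 1 n)

/-- The largest entry of a word. -/
def maxEntry (w : List ℕ) : ℕ :=
  w.foldr max 0

/-- The factor `α` in the decomposition `w = α m β` of a word at its largest entry `m`. -/
def beforeMax (w : List ℕ) : List ℕ :=
  w.take (w.idxOf (maxEntry w))

/-- The factor `β` in the decomposition `w = α m β` of a word at its largest entry `m`. -/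
def afterMax (w : List ℕ) : List ℕ :=
  w.drop (w.idxOf (maxEntry w) + 1)

theorem maxEntry_mem (a : ℕ) (l : List ℕ) : maxEntry (a :: l) ∈ a :: l := by
  induction l generalizing a with
  | nil => simp [maxEntry]
  | cons b l ih =>
    have h : maxEntry (a :: b :: l) = max a (maxEntry (b :: l)) := rfl
    rcases max_choice a (maxEntry (b :: l)) with h' | h'
    · rw [h, h']; exact List.mem_cons_self
    · rw [h, h']; exact List.mem_cons_of_mem _ (ih b)

theorem beforeMax_length_lt (a : ℕ) (l : List ℕ) :
    (beforeMax (a :: l)).length < (a :: l).length := by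
  have h := List.idxOf_lt_length_of_mem (maxEntry_mem a l)
  rw [beforeMax, List.length_take]
  exact lt_of_le_of_lt (min_le_left _ _) h

theorem afterMax_length_lt (a : ℕ) (l : List ℕ) :
    (afterMax (a :: l)).length < (a :: l).length := by
  rw [afterMax, List.length_drop]
  have : 0 < (a :: l).length := Nat.succ_pos _
  omega

/-- Knuth's stack-sorting operator: `S(ε) = ε` and `S(α m β) = S(α) S(β) m`, where `m` is the
largest entry of the word `α m β`. -/
def stackSort : List ℕ → List ℕ
  | [] => []
  | a :: l =>
      stackSort (beforeMax (a :: l)) ++ stackSort (afterMax (a :: l)) ++ [maxEntry (a :: l)]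
termination_by w => w.length
decreasing_by
  · exact beforeMax_length_lt a l
  · exact afterMax_length_lt a l

/-- The reversal operator. -/
def reversal (w : List ℕ) : List ℕ :=
  w.reverse

/-- `A` is a (possibly empty) composition of the operators `S` and `R`. -/
inductive IsComposition : (List ℕ → List ℕ) → Prop
  | identity : IsComposition id
  | stackSort_comp {A : List ℕ → List ℕ} : IsComposition A → IsComposition (stackSort ∘ A)
  | reversal_comp {A : List ℕ → List ℕ} : IsComposition A → IsComposition (reversal ∘ A)

/-- The set of permutations of `{1, …, n}` that are sorted by `B`, i.e. sent by `B` to `1 2 … n`. -/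
def sortedBy (n : ℕ) (B : List ℕ → List ℕ) : Set (List ℕ) :=
  {θ | IsPermutation n θ ∧ B θ = List.range' 1 n}

theorem sortedBy_finite (n : ℕ) (B : List ℕ → List ℕ) : (sortedBy n B).Finite := by
  refine ((List.range' 1 n).permutations.toFinset.finite_toSet).subset ?_
  rintro θ ⟨h, -⟩
  simpa [IsPermutation] using h

/-- The sum `α ⊕ β = α (β + |α|)` of two permutations. -/
def directSum (α β : List ℕ) : List ℕ :=
  α ++ β.map (· + α.length)

/-- The skew sum `α ⊖ β = (α + |β|) β` of two permutations. -/
def skewSum (α β : List ℕ) : List ℕ :=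
  α.map (· + β.length) ++ β

/-- The map `P`: `P(ε) = ε`, and if `π = α ⊕ (1 ⊖ β)` then `P(π) = (P(α) ⊕ 1) ⊖ P(β)`.
A nonempty permutation `π` avoiding `231` is of the form `α ⊕ (1 ⊖ β)` in exactly one way: `α` is
what precedes the largest entry of `π`, and `β` is what follows it, lowered by `|α|`.
Only the values of `P` on permutations avoiding `231` are meaningful. -/
def bijP : List ℕ → List ℕ
  | [] => []
  | a :: l =>
      skewSum (directSum (bijP (beforeMax (a :: l))) [1])
        (bijP ((afterMax (a :: l)).map (· - (beforeMax (a :: l)).length)))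
termination_by w => w.length
decreasing_by
  · exact beforeMax_length_lt a l
  · rw [List.length_map]; exact afterMax_length_lt a l

/-- The relabeling `λ_π` of the entries of `π`, determined by `P(π) = λ_π ∘ π`: the value that
stands in `π` at some position is sent to the value that stands in `P(π)` at that position. -/
def relabeling (π : List ℕ) (x : ℕ) : ℕ :=
  (bijP π).getD (π.idxOf x) 0

/-- The map `Φ_A`, given by `Φ_A(θ) = λ_{A(θ)} ∘ θ`. -/
def Phi (A : List ℕ → List ℕ) (θ : List ℕ) : List ℕ :=
  θ.map (relabeling (A θ))

/-- The entry `π(i)`, for a position `1 ≤ i ≤ |π|`. -/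
def entry (π : List ℕ) (i : ℕ) : ℕ :=
  π.getD (i - 1) 0

/-- The positions of the left-to-right maxima. -/
def lrMaxPositions (π : List ℕ) : Finset ℕ :=
  {i ∈ Finset.Icc 1 π.length | ∀ j < i, 1 ≤ j → entry π j < entry π i}

/-- The positions of the right-to-left maxima. -/
def rlMaxPositions (π : List ℕ) : Finset ℕ :=
  {i ∈ Finset.Icc 1 π.length | ∀ j ≤ π.length, i < j → entry π j < entry π i}

/-- The number of left-to-right maxima. -/
def lrMaxCount (π : List ℕ) : ℕ :=
  (lrMaxPositions π).card

/-- The number of right-to-left maxima. -/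
def rlMaxCount (π : List ℕ) : ℕ :=
  (rlMaxPositions π).card

/-- The letters of up-down words. -/
inductive UpDown
  | u
  | d

/-- The up-down word: its `i`-th letter, for `1 ≤ i < |π|`, is `u` if `π(i) < π(i+1)`, and `d`
otherwise. -/
def upDownWord (π : List ℕ) : List UpDown :=
  (List.range' 1 (π.length - 1)).map
    fun i => if entry π i < entry π (i + 1) then UpDown.u else UpDown.d

/-- `zeil(π)`, for a permutation `π` of `{1, …, n}`: the largest `k ≤ n` such that
`n (n-1) … (n-k+1)` is a (not necessarily contiguous) subword of `π`. -/
def zeil (π : List ℕ) : ℕ :=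
  Nat.findGreatest
    (fun k => ((List.range' (π.length - k + 1) k).reverse).Sublist π) π.length

/-- `Rzeil(π)`, for a permutation `π` of `{1, …, n}`: the largest `k ≤ n` such that
`(n-k+1) … (n-1) n` is a (not necessarily contiguous) subword of `π`. -/
def Rzeil (π : List ℕ) : ℕ :=
  Nat.findGreatest (fun k => (List.range' (π.length - k + 1) k).Sublist π) π.length

/-- The statistic `f` has the same distribution on `X` and on `Y`. -/
def Equidistributed {T : Type*} (f : List ℕ → T) (X Y : Set (List ℕ)) : Prop :=
  ∀ v : T, {θ ∈ X | f θ = v}.ncard = {θ ∈ Y | f θ = v}.ncard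

/-- The statistic `f` is preserved by `F` on `X`. -/
def PreservedBy {T : Type*} (F : List ℕ → List ℕ) (f : List ℕ → T) (X : Set (List ℕ)) : Prop :=
  ∀ θ ∈ X, f (F θ) = f θ

/-- The statistic `f` is equidistributed across the permutations of `{1, …, n}` sorted by `S ∘ A`
and those sorted by `S ∘ R ∘ A`, and it is preserved by `Φ_A`. -/
def Transferred {T : Type*} (n : ℕ) (A : List ℕ → List ℕ) (f : List ℕ → T) : Prop :=
  Equidistributed f (sortedBy n (stackSort ∘ A)) (sortedBy n (stackSort ∘ reversal ∘ A)) ∧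
    PreservedBy (Phi A) f (sortedBy n (stackSort ∘ A))

end StackSorting

namespace StackSorting

/-! Everything rests on the shape of the decreasing binary tree of a word, whose root is the largest
entry and whose subtrees come from the two factors around it. The word is the inorder reading of
this tree, and `stackSort` is its postorder reading. A relabeling of entries that keeps the shape of
`stackSort w` also keeps the shape of `w`, and it then commutes with `stackSort`; reversal mirrors
trees, so the same holds for it. By induction, a relabeling that keeps the shape of `A θ` keeps the
shape of `θ` and commutes with `A` (`IsComposition.sameShape_and_map`).

The map P keeps shapes and is a bijection from the words sorted by S to those sorted by S ∘ R. Hence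
its relabeling may be applied to `θ` itself: `Phi A θ` has the shape of `θ`, and `A (Phi A θ) = bijP
(A θ)`. Bijectivity of `Phi A` follows from that of P, since relabelings can be undone. Maxima and
the up-down word depend on the shape alone.

For zeil, if the k largest entries form a decreasing subword of `w`, then `stackSort w` ends in them
in increasing order. The shape of such an ending forces a relabeling to fix these entries.
Increasing subwords survive `stackSort`, and one reversal makes them decreasing, which reduces Rzeil
to the same fact. -/

theorem maxEntry_le {w : List ℕ} {m : ℕ} (h : ∀ y ∈ w, y ≤ m) : maxEntry w ≤ m := by
  induction w with
  | nil => simp [maxEntry]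
  | cons a w ih =>
    exact max_le (h a (by simp)) (ih fun y hy => h y (by simp [hy]))

theorem le_maxEntry {w : List ℕ} {y : ℕ} (h : y ∈ w) : y ≤ maxEntry w := by
  induction w with
  | nil => simp at h
  | cons a w ih =>
    change y ≤ max a (maxEntry w)
    rcases List.mem_cons.1 h with rfl | h
    · exact le_max_left _ _
    · exact (ih h).trans (le_max_right _ _)

/-! ### Decomposition of a word at its largest entry -/

section Node

variable {α β : List ℕ} {m : ℕ}

theorem maxEntry_node (hα : ∀ y ∈ α, y < m) (hβ : ∀ y ∈ β, y < m) :
    maxEntry (α ++ m :: β) = m := by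
  apply le_antisymm
  · apply maxEntry_le
    intro y hy
    rcases List.mem_append.1 hy with h | h
    · exact (hα y h).le
    · rcases List.mem_cons.1 h with rfl | h
      · exact le_rfl
      · exact (hβ y h).le
  · exact le_maxEntry (by simp)

theorem idxOf_node (hα : ∀ y ∈ α, y < m) : (α ++ m :: β).idxOf m = α.length := by
  rw [List.idxOf_append_of_notMem fun h => lt_irrefl m (hα m h)]
  simp

theorem beforeMax_node (hα : ∀ y ∈ α, y < m) (hβ : ∀ y ∈ β, y < m) :
    beforeMax (α ++ m :: β) = α := by
  rw [beforeMax, maxEntry_node hα hβ, idxOf_node hα]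
  simp

theorem afterMax_node (hα : ∀ y ∈ α, y < m) (hβ : ∀ y ∈ β, y < m) :
    afterMax (α ++ m :: β) = β := by
  rw [afterMax, maxEntry_node hα hβ, idxOf_node hα, ← List.drop_drop]
  simp

theorem stackSort_nil : stackSort [] = [] := by
  rw [stackSort]

theorem stackSort_node (hα : ∀ y ∈ α, y < m) (hβ : ∀ y ∈ β, y < m) :
    stackSort (α ++ m :: β) = stackSort α ++ stackSort β ++ [m] := by
  have h₁ := beforeMax_node hα hβ
  have h₂ := afterMax_node hα hβ
  have h₃ := maxEntry_node hα hβ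
  obtain ⟨a, l, h⟩ : ∃ a l, α ++ m :: β = a :: l := by
    cases α <;> simp
  rw [h] at h₁ h₂ h₃ ⊢
  rw [stackSort, h₁, h₂, h₃]

theorem bijP_nil : bijP [] = [] := by
  rw [bijP]

theorem bijP_node (hα : ∀ y ∈ α, y < m) (hβ : ∀ y ∈ β, y < m) :
    bijP (α ++ m :: β) =
      skewSum (directSum (bijP α) [1]) (bijP (β.map (· - α.length))) := by
  have h₁ := beforeMax_node hα hβ
  have h₂ := afterMax_node hα hβ
  obtain ⟨a, l, h⟩ : ∃ a l, α ++ m :: β = a :: l := by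
    cases α <;> simp
  rw [h] at h₁ h₂ ⊢
  rw [bijP, h₁, h₂]

end Node

theorem exists_node {w : List ℕ} (hw : w.Nodup) (h : w ≠ []) :
    ∃ α m β, w = α ++ m :: β ∧ (∀ y ∈ α, y < m) ∧ ∀ y ∈ β, y < m := by
  obtain ⟨a, l, rfl⟩ := List.exists_cons_of_ne_nil h
  obtain ⟨α, β, hαβ⟩ := List.append_of_mem (maxEntry_mem a l)
  have hle : ∀ y ∈ a :: l, y ≤ maxEntry (a :: l) := fun y => le_maxEntry
  generalize maxEntry (a :: l) = m at hαβ hle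
  rw [hαβ] at hw hle
  rw [List.nodup_middle, List.nodup_cons] at hw
  refine ⟨α, m, β, hαβ, fun y hy => ?_, fun y hy => ?_⟩
  · refine lt_of_le_of_ne (hle y (by simp [hy])) ?_
    rintro rfl
    exact hw.1 (by simp [hy])
  · refine lt_of_le_of_ne (hle y (by simp [hy])) ?_
    rintro rfl
    exact hw.1 (by simp [hy])

/-- Induction along the decomposition of a word with distinct entries at its largest entry. -/
theorem node_induction {motive : (w : List ℕ) → w.Nodup → Prop} (nil : motive [] List.nodup_nil)
    (node : ∀ α m β, (hn : (α ++ m :: β).Nodup) → (∀ y ∈ α, y < m) → (∀ y ∈ β, y < m) →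
      motive α hn.of_append_left → motive β hn.of_append_right.of_cons → motive (α ++ m :: β) hn)
    (w : List ℕ) (hw : w.Nodup) : motive w hw := by
  induction hn : w.length using Nat.strong_induction_on generalizing w with
  | _ n ih =>
    by_cases h : w = []
    · subst h
      exact nil
    obtain ⟨α, m, β, rfl, hα, hβ⟩ := exists_node hw h
    have hl : α.length + (β.length + 1) = n := by simpa using hn
    exact node α m β hw hα hβ (ih _ (by omega) α _ rfl) (ih _ (by omega) β _ rfl)

theorem stackSort_perm (w : List ℕ) : (stackSort w).Perm w := by
  induction hn : w.length using Nat.strong_induction_on generalizing w with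
  | _ n ih =>
    cases w with
    | nil => rw [stackSort_nil]
    | cons a l =>
      rw [stackSort]
      have h₁ := ih _ (hn ▸ beforeMax_length_lt a l) _ rfl
      have h₂ := ih _ (hn ▸ afterMax_length_lt a l) _ rfl
      refine ((h₁.append h₂).append_right _).trans ?_
      have h := List.idxOf_lt_length_of_mem (maxEntry_mem a l)
      have hd := List.drop_eq_getElem_cons h
      rw [List.getElem_idxOf] at hd
      have ht := List.take_append_drop ((a :: l).idxOf (maxEntry (a :: l))) (a :: l)
      rw [hd] at ht
      conv_rhs => rw [← ht]
      rw [List.append_assoc]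
      exact List.Perm.append_left _ (List.perm_append_comm.trans (by rfl))

/-! ### Shapes of decreasing trees -/

/-- `w` and `w'` have decreasing binary trees of the same shape: at every stage of the
decomposition, the largest entries stand at the same positions. -/
inductive SameShape : List ℕ → List ℕ → Prop
  | nil : SameShape [] []
  | node {α α' β β' : List ℕ} {m m' : ℕ} : SameShape α α' → SameShape β β' →
      (∀ y ∈ α, y < m) → (∀ y ∈ β, y < m) → (∀ y ∈ α', y < m') → (∀ y ∈ β', y < m') →
      SameShape (α ++ m :: β) (α' ++ m' :: β')

namespace SameShape

variable {w w' : List ℕ}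

theorem symm (h : SameShape w w') : SameShape w' w := by
  induction h with
  | nil => exact nil
  | node _ _ h₁ h₂ h₃ h₄ ih₁ ih₂ => exact node ih₁ ih₂ h₃ h₄ h₁ h₂

theorem length_eq (h : SameShape w w') : w.length = w'.length := by
  induction h with
  | nil => rfl
  | node _ _ _ _ _ _ ih₁ ih₂ => simp [ih₁, ih₂]

theorem reverse (h : SameShape w w') : SameShape w.reverse w'.reverse := by
  induction h with
  | nil => exact nil
  | node _ _ h₁ h₂ h₃ h₄ ih₁ ih₂ =>
    simp only [List.reverse_append, List.reverse_cons, List.append_assoc, List.singleton_append]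
    exact node ih₂ ih₁ (by simpa using h₂) (by simpa using h₁) (by simpa using h₄)
      (by simpa using h₃)

/-- A cut in inorder falls either within the left subtree, which alone is trimmed and kept, or after
the root, where only the right subtree is trimmed. -/
theorem take (h : SameShape w w') (k : ℕ) : SameShape (w.take k) (w'.take k) := by
  induction h generalizing k with
  | nil => simpa using nil
  | @node α α' β β' m m' hα hβ h₁ h₂ h₃ h₄ ih₁ ih₂ =>
    have hl := hα.length_eq
    rw [List.take_append, List.take_append, ← hl]
    rcases le_or_gt k α.length with hk | hk
    · rw [Nat.sub_eq_zero_of_le hk]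
      simpa using ih₁ k
    · obtain ⟨j, rfl⟩ := Nat.exists_eq_add_of_lt hk
      have : α.length + j + 1 - α.length = j + 1 := by omega
      rw [this, List.take_of_length_le (l := α) (by omega),
        List.take_of_length_le (l := α') (by omega)]
      exact node hα (ih₂ j) h₁ (fun y hy => h₂ y (List.mem_of_mem_take hy)) h₃
        (fun y hy => h₄ y (List.mem_of_mem_take hy))

theorem drop (h : SameShape w w') (k : ℕ) : SameShape (w.drop k) (w'.drop k) := by
  have := (h.reverse.take (w.length - k)).reverse
  rw [List.take_reverse, h.length_eq, List.take_reverse, ← h.length_eq] at this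
  rw [List.reverse_reverse, List.reverse_reverse] at this
  rcases le_or_gt k w.length with hk | hk
  · rwa [show w.length - (w.length - k) = k by omega] at this
  · rw [List.drop_of_length_le hk.le, List.drop_of_length_le (h.length_eq ▸ hk.le)]
    exact nil

theorem of_append {u v u' v' : List ℕ} (h : SameShape (u ++ v) (u' ++ v'))
    (hl : u.length = u'.length) : SameShape u u' ∧ SameShape v v' := by
  constructor
  · simpa [hl] using (h.take u.length)
  · simpa [hl] using (h.drop u.length)

/-- The last letter is the largest exactly when the root has no right subtree, which the shape
records. -/
theorem lt_last {u u' : List ℕ} {x x' : ℕ} (h : SameShape (u ++ [x]) (u' ++ [x']))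
    (hx : ∀ y ∈ u, y < x) : ∀ y ∈ u', y < x' := by
  generalize hw : u ++ [x] = w at h
  generalize hw' : u' ++ [x'] = w' at h
  cases h with
  | nil => simp at hw
  | @node α α' β β' m m' hα hβ h₁ h₂ h₃ h₄ =>
    have hl := hβ.length_eq
    rcases List.eq_nil_or_concat' β with rfl | ⟨γ, z, rfl⟩
    · obtain rfl : β' = [] := by simpa [eq_comm] using hl
      obtain ⟨rfl, h⟩ := List.append_inj' hw' rfl
      obtain rfl : x' = m' := by simpa using h
      exact h₃
    · rw [← List.cons_append, ← List.append_assoc] at hw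
      obtain ⟨rfl, h⟩ := List.append_inj' hw rfl
      obtain rfl : x = z := by simpa using h
      have a₁ := hx m (by simp)
      have a₂ := h₂ x (by simp)
      omega

theorem lt_last_iff {u u' : List ℕ} {x x' : ℕ} (h : SameShape (u ++ [x]) (u' ++ [x'])) :
    (∀ y ∈ u, y < x) ↔ ∀ y ∈ u', y < x' :=
  ⟨h.lt_last, h.symm.lt_last⟩

theorem lt_head_iff {u u' : List ℕ} {x x' : ℕ} (h : SameShape (x :: u) (x' :: u')) :
    (∀ y ∈ u, y < x) ↔ ∀ y ∈ u', y < x' := by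
  have := h.reverse
  rw [List.reverse_cons, List.reverse_cons] at this
  simpa using this.lt_last_iff

/-- A relabeling that preserves the shape of a word commutes with stack-sorting. -/
theorem stackSort_map {f : ℕ → ℕ} (hw : w.Nodup) (h : SameShape w (w.map f)) :
    stackSort (w.map f) = (stackSort w).map f := by
  induction w, hw using node_induction with
  | nil => simp [stackSort_nil]
  | node α m β hn hα hβ ih₁ ih₂ =>
    simp only [List.map_append, List.map_cons] at h
    have hs := h.of_append (by simp)
    have hβs : SameShape β (β.map f) := by simpa using hs.2.drop 1
    -- The entry `m` is largest at the end of the prefix `α m` and at the start of the suffix `m β`;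
    -- both properties pass to the images by shape.
    have hα' : ∀ y ∈ α.map f, y < f m := by
      rw [List.append_cons, List.append_cons (α.map f)] at h
      exact (h.of_append (by simp)).1.lt_last hα
    have hβ' : ∀ y ∈ β.map f, y < f m := hs.2.lt_head_iff.1 hβ
    rw [List.map_append, List.map_cons, stackSort_node hα' hβ', stackSort_node hα hβ,
      ih₁ hs.1, ih₂ hβs]
    simp

/-- A relabeling that preserves the shape of `S(w)` preserves the shape of `w`. -/
theorem of_stackSort {f : ℕ → ℕ} (hw : w.Nodup)
    (h : SameShape (stackSort w) ((stackSort w).map f)) : SameShape w (w.map f) := by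
  induction w, hw using node_induction with
  | nil => exact nil
  | node α m β hn hα hβ ih₁ ih₂ =>
    rw [stackSort_node hα hβ, List.map_append] at h
    have hs := (h.of_append (by simp)).1
    rw [List.map_append] at hs
    have hs' := hs.of_append (by simp)
    -- In `S(w)` the root `m` stands last, so equality of shapes makes `f m` exceed the images of
    -- all other entries.
    have hlt := h.lt_last (by
      intro y hy
      rcases List.mem_append.1 hy with hy | hy
      · exact hα y ((stackSort_perm α).mem_iff.1 hy)
      · exact hβ y ((stackSort_perm β).mem_iff.1 hy))
    rw [List.map_append, List.map_cons]
    refine node (ih₁ hs'.1) (ih₂ hs'.2) hα hβ ?_ ?_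
    · intro y hy
      obtain ⟨z, hz, rfl⟩ := List.mem_map.1 hy
      exact hlt _ (List.mem_map_of_mem (List.mem_append_left _ ((stackSort_perm α).mem_iff.2 hz)))
    · intro y hy
      obtain ⟨z, hz, rfl⟩ := List.mem_map.1 hy
      exact hlt _ (List.mem_map_of_mem (List.mem_append_right _ ((stackSort_perm β).mem_iff.2 hz)))

theorem map_strictMono {f : ℕ → ℕ} (hf : StrictMono f) (hw : w.Nodup) :
    SameShape w (w.map f) := by
  induction w, hw using node_induction with
  | nil => exact nil
  | node α m β hn hα hβ ih₁ ih₂ =>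
    rw [List.map_append, List.map_cons]
    refine node ih₁ ih₂ hα hβ ?_ ?_
    · intro y hy
      obtain ⟨z, hz, rfl⟩ := List.mem_map.1 hy
      exact hf (hα z hz)
    · intro y hy
      obtain ⟨z, hz, rfl⟩ := List.mem_map.1 hy
      exact hf (hβ z hz)

/-- Strictly increasing relabelings of both words do not affect the shapes. -/
theorem map_map {f g : ℕ → ℕ} (hf : StrictMono f) (hg : StrictMono g) (h : SameShape w w') :
    SameShape (w.map f) (w'.map g) := by
  induction h with
  | nil => exact nil
  | node _ _ h₁ h₂ h₃ h₄ ih₁ ih₂ =>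
    rw [List.map_append, List.map_cons, List.map_append, List.map_cons]
    refine node ih₁ ih₂ ?_ ?_ ?_ ?_ <;>
    · intro y hy
      obtain ⟨z, hz, rfl⟩ := List.mem_map.1 hy
      first
      | exact hf (h₁ z hz)
      | exact hf (h₂ z hz)
      | exact hg (h₃ z hz)
      | exact hg (h₄ z hz)

end SameShape

theorem stackSort_map_add {w : List ℕ} (hw : w.Nodup) (k : ℕ) :
    stackSort (w.map (· + k)) = (stackSort w).map (· + k) :=
  (SameShape.map_strictMono (fun _ _ h => Nat.add_lt_add_right h k) hw).stackSort_map hw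

/-! ### Relabelings and compositions of S and R -/

namespace IsComposition

variable {A : List ℕ → List ℕ}

theorem perm (hA : IsComposition A) (w : List ℕ) : (A w).Perm w := by
  induction hA with
  | identity => exact .rfl
  | stackSort_comp _ ih => exact (stackSort_perm _).trans ih
  | reversal_comp _ ih => exact (List.reverse_perm _).trans ih

/-- Peel off the outermost operator: equality of shapes is pulled back to its input, and the
induction hypothesis applies to the inner composition. The operator then commutes with the
relabeling. -/
theorem sameShape_and_map (hA : IsComposition A) {w : List ℕ} {f : ℕ → ℕ} (hw : w.Nodup)
    (h : SameShape (A w) ((A w).map f)) :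
    SameShape w (w.map f) ∧ A (w.map f) = (A w).map f := by
  induction hA with
  | identity => exact ⟨h, rfl⟩
  | @stackSort_comp A hA ih =>
    have hn : (A w).Nodup := (hA.perm w).nodup_iff.2 hw
    have hs := SameShape.of_stackSort hn h
    obtain ⟨h₁, h₂⟩ := ih hs
    refine ⟨h₁, ?_⟩
    change stackSort (A (w.map f)) = _
    rw [h₂, hs.stackSort_map hn]
    rfl
  | @reversal_comp A hA ih =>
    have hs : SameShape (A w) ((A w).map f) := by
      simpa [reversal, List.map_reverse] using h.reverse
    obtain ⟨h₁, h₂⟩ := ih hs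
    refine ⟨h₁, ?_⟩
    change (A (w.map f)).reverse = _
    rw [h₂]
    simp [reversal]

end IsComposition

/-! ### Words sorted by S and the map P -/

theorem range'_add_one_eq_map (a b : ℕ) :
    List.range' (a + 1) b = (List.range' 1 b).map (· + a) := by
  rw [add_comm, List.range'_eq_map_range, List.range'_eq_map_range, List.map_map]
  apply List.map_congr_left
  intro x _
  simp only [Function.comp]
  omega

theorem range'_split (a b : ℕ) :
    List.range' 1 (a + b + 1) =
      List.range' 1 a ++ (List.range' 1 b).map (· + a) ++ [a + b + 1] := by
  rw [List.range'_concat, ← range'_add_one_eq_map, ← List.range'_append]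
  simp only [one_mul, add_comm 1]

theorem nodup_of_stackSort_eq {w : List ℕ} {s n : ℕ} (h : stackSort w = List.range' s n) :
    w.Nodup :=
  (stackSort_perm w).nodup_iff.1 (h ▸ List.nodup_range')

theorem length_of_stackSort_eq {w : List ℕ} {s n : ℕ} (h : stackSort w = List.range' s n) :
    w.length = n := by
  simpa [h] using (stackSort_perm w).length_eq.symm

theorem lt_of_stackSort_eq {w : List ℕ} {n : ℕ} (h : stackSort w = List.range' 1 n) :
    ∀ y ∈ w, y < n + 1 := by
  intro y hy
  have := (stackSort_perm w).mem_iff.2 hy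
  rw [h, List.mem_range'_1] at this
  omega

theorem lt_of_mem_map_add {w : List ℕ} {b c k : ℕ} (h : ∀ y ∈ w, y < b + 1) (hc : b + k < c) :
    ∀ y ∈ w.map (· + k), y < c := by
  intro y hy
  obtain ⟨z, hz, rfl⟩ := List.mem_map.1 hy
  have := h z hz
  omega

theorem stackSort_sum {a b : ℕ} {α β : List ℕ} (hα : stackSort α = List.range' 1 a)
    (hβ : stackSort β = List.range' 1 b) :
    stackSort (α ++ (a + b + 1) :: β.map (· + a)) = List.range' 1 (a + b + 1) := by
  rw [stackSort_node, stackSort_map_add (nodup_of_stackSort_eq hβ), hα, hβ, range'_split]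
  · exact fun y hy => (lt_of_stackSort_eq hα y hy).trans_le (by omega)
  · exact lt_of_mem_map_add (lt_of_stackSort_eq hβ) (by omega)

/-- The words sorted by `S` are built from the empty word by `α, β ↦ α ⊕ (1 ⊖ β)`. -/
theorem sorted_induction
    {motive : (n : ℕ) → (w : List ℕ) → stackSort w = List.range' 1 n → Prop}
    (nil : motive 0 [] stackSort_nil)
    (node : ∀ a b α β, (hα : stackSort α = List.range' 1 a) →
      (hβ : stackSort β = List.range' 1 b) → motive a α hα → motive b β hβ →
      motive (a + b + 1) (α ++ (a + b + 1) :: β.map (· + a)) (stackSort_sum hα hβ))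
    (n : ℕ) (w : List ℕ) (h : stackSort w = List.range' 1 n) : motive n w h := by
  induction n using Nat.strong_induction_on generalizing w with
  | _ n ih =>
    by_cases hw : w = []
    · subst hw
      obtain rfl : 0 = n := length_of_stackSort_eq h
      exact nil
    obtain ⟨α, m, β, rfl, hα, hβ⟩ := exists_node (nodup_of_stackSort_eq h) hw
    have hl := length_of_stackSort_eq h
    have hs := h
    rw [stackSort_node hα hβ] at hs
    obtain ⟨a, ha⟩ : ∃ a, α.length = a := ⟨_, rfl⟩
    obtain ⟨b, hb⟩ : ∃ b, β.length = b := ⟨_, rfl⟩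
    obtain rfl : a + b + 1 = n := by simp at hl; omega
    rw [range'_split] at hs
    obtain ⟨ht, hm⟩ := List.append_inj' hs rfl
    obtain rfl : m = a + b + 1 := by simpa using hm
    obtain ⟨h₁, h₂⟩ := List.append_inj ht (by simp [(stackSort_perm α).length_eq, ha])
    -- This bound makes the truncated subtraction of `a` reversible on `β`.
    have hge : ∀ y ∈ β, a ≤ y := by
      intro y hy
      have := (stackSort_perm β).mem_iff.2 hy
      rw [h₂] at this
      obtain ⟨z, -, rfl⟩ := List.mem_map.1 this
      exact Nat.le_add_left _ _
    obtain ⟨γ, rfl⟩ : ∃ γ : List ℕ, β = γ.map (· + a) := by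
      refine ⟨β.map (· - a), ?_⟩
      rw [List.map_map]
      conv_lhs => rw [← List.map_id β]
      apply List.map_congr_left
      intro y hy
      have := hge y hy
      simp only [Function.comp, id]
      omega
    have hγn : γ.Nodup := by
      refine List.Nodup.of_map (· + a) ((stackSort_perm _).nodup_iff.1 ?_)
      rw [h₂]
      exact List.Nodup.map (add_left_injective a) List.nodup_range'
    rw [stackSort_map_add hγn] at h₂
    have h₃ := List.map_injective_iff.2 (add_left_injective a) h₂
    exact node a b α γ h₁ h₃ (ih a (by omega) α h₁) (ih b (by omega) γ h₃)

theorem length_bijP (w : List ℕ) : (bijP w).length = w.length := by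
  induction hn : w.length using Nat.strong_induction_on generalizing w with
  | _ n ih =>
    cases w with
    | nil => rw [bijP_nil, hn]
    | cons a l =>
      rw [bijP]
      have h₁ := ih _ (hn ▸ beforeMax_length_lt a l) _ rfl
      have h₂ := ih _ (hn ▸ afterMax_length_lt a l)
        ((afterMax (a :: l)).map (· - (beforeMax (a :: l)).length)) (by simp)
      simp only [skewSum, directSum, List.length_append, List.length_map, List.length_singleton,
        h₁, h₂]
      rw [beforeMax, afterMax, List.length_take, List.length_drop]
      have := List.idxOf_lt_length_of_mem (maxEntry_mem a l)
      omega

/-- The largest entry keeps its place; instead of the right factor being raised by `a`, the left one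
is raised by `b`. -/
theorem bijP_sum {a b : ℕ} {α β : List ℕ} (hα : stackSort α = List.range' 1 a)
    (hβ : stackSort β = List.range' 1 b) :
    bijP (α ++ (a + b + 1) :: β.map (· + a)) =
      (bijP α).map (· + b) ++ (a + b + 1) :: bijP β := by
  have ha := length_of_stackSort_eq hα
  have hb := length_of_stackSort_eq hβ
  rw [bijP_node]
  · have : (β.map (· + a)).map (· - α.length) = β := by
      rw [List.map_map, ha]
      conv_rhs => rw [← List.map_id β]
      exact List.map_congr_left fun y _ => by simp
    rw [this]
    simp only [skewSum, directSum, length_bijP, ha, hb]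
    simp
    omega
  · exact fun y hy => (lt_of_stackSort_eq hα y hy).trans_le (by omega)
  · exact lt_of_mem_map_add (lt_of_stackSort_eq hβ) (by omega)

/-- `P` maps the words sorted by `S` to words sorted by `S ∘ R` and keeps the shapes. -/
theorem bijP_spec {n : ℕ} {w : List ℕ} (h : stackSort w = List.range' 1 n) :
    stackSort (bijP w).reverse = List.range' 1 n ∧ SameShape w (bijP w) := by
  induction n, w, h using sorted_induction with
  | nil => simp [bijP_nil, stackSort_nil, SameShape.nil]
  | node a b α β hα hβ ih₁ ih₂ =>
    rw [bijP_sum hα hβ]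
    have l₁ := lt_of_stackSort_eq ih₁.1
    have l₂ := lt_of_stackSort_eq ih₂.1
    constructor
    · have := stackSort_sum ih₂.1 ih₁.1
      rw [add_comm b a] at this
      simpa [List.map_reverse] using this
    · refine .node ?_ ?_ ?_ ?_ ?_ ?_
      · simpa using ih₁.2.map_map strictMono_id (g := (· + b))
          fun _ _ h => Nat.add_lt_add_right h b
      · simpa using ih₂.2.map_map (f := (· + a)) (fun _ _ h => Nat.add_lt_add_right h a)
          strictMono_id
      · exact fun y hy => (lt_of_stackSort_eq hα y hy).trans_le (by omega)
      · exact lt_of_mem_map_add (lt_of_stackSort_eq hβ) (by omega)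
      · exact lt_of_mem_map_add (by simpa using l₁) (by omega)
      · exact fun y hy => (l₂ y (by simpa using hy)).trans_le (by omega)

/-- The largest entry of the image separates the images of the two factors, and the length of the
right one determines the shift of the left one. -/
theorem bijP_injOn {n : ℕ} {v w : List ℕ} (hv : stackSort v = List.range' 1 n)
    (hw : stackSort w = List.range' 1 n) (h : bijP v = bijP w) : v = w := by
  induction n, v, hv using sorted_induction generalizing w with
  | nil =>
    have := length_of_stackSort_eq hw
    exact (List.eq_nil_of_length_eq_zero this).symm
  | node a b α β hα hβ ih₁ ih₂ =>
    generalize hn : a + b + 1 = n at hw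
    cases n, w, hw using sorted_induction with
    | nil => simp at hn
    | node c d γ δ hγ hδ _ _ =>
      rw [bijP_sum hα hβ, bijP_sum hγ hδ] at h
      obtain h₁ := (bijP_spec hα).1
      obtain h₂ := (bijP_spec hβ).1
      obtain h₃ := (bijP_spec hγ).1
      obtain h₄ := (bijP_spec hδ).1
      have k₁ : ∀ y ∈ (bijP α).map (· + b), y < a + b + 1 :=
        lt_of_mem_map_add (by simpa using lt_of_stackSort_eq h₁) (by omega)
      have k₂ : ∀ y ∈ bijP β, y < a + b + 1 :=
        fun y hy => (lt_of_stackSort_eq h₂ y (by simpa using hy)).trans_le (by omega)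
      have k₃ : ∀ y ∈ (bijP γ).map (· + d), y < c + d + 1 :=
        lt_of_mem_map_add (by simpa using lt_of_stackSort_eq h₃) (by omega)
      have k₄ : ∀ y ∈ bijP δ, y < c + d + 1 :=
        fun y hy => (lt_of_stackSort_eq h₄ y (by simpa using hy)).trans_le (by omega)
      have e₁ := congrArg beforeMax h
      have e₂ := congrArg afterMax h
      rw [beforeMax_node k₁ k₂, beforeMax_node k₃ k₄] at e₁
      rw [afterMax_node k₁ k₂, afterMax_node k₃ k₄] at e₂
      have hbd : b = d := by
        have := congrArg List.length e₂
        rwa [length_bijP, length_bijP, length_of_stackSort_eq hβ, length_of_stackSort_eq hδ]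
          at this
      obtain rfl := hbd
      obtain rfl : a = c := by omega
      rw [ih₁ hγ (List.map_injective_iff.2 (add_left_injective b) e₁), ih₂ hδ e₂]

/-- Decompose the reversed target, which is sorted by S; reversing back exchanges its factors and
exhibits a value of P. -/
theorem exists_bijP_eq {n : ℕ} {v : List ℕ} (h : stackSort v.reverse = List.range' 1 n) :
    ∃ w, stackSort w = List.range' 1 n ∧ bijP w = v := by
  suffices ∀ u, stackSort u = List.range' 1 n →
      ∃ w, stackSort w = List.range' 1 n ∧ bijP w = u.reverse by
    simpa using this _ h
  intro u hu
  clear h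
  induction n, u, hu using sorted_induction with
  | nil => exact ⟨[], by simp [stackSort_nil], by simp [bijP_nil]⟩
  | node b a β α hβ hα ih₂ ih₁ =>
    obtain ⟨γ, hγ, eγ⟩ := ih₁
    obtain ⟨δ, hδ, eδ⟩ := ih₂
    refine ⟨γ ++ (a + b + 1) :: δ.map (· + a), ?_, ?_⟩
    · rw [stackSort_sum hγ hδ, add_comm a b]
    · rw [bijP_sum hγ hδ, eγ, eδ, add_comm a b]
      simp

theorem map_relabeling {w : List ℕ} (hw : w.Nodup) : w.map (relabeling w) = bijP w := by
  apply List.ext_getElem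
  · rw [List.length_map, length_bijP]
  · intro i h₁ h₂
    rw [List.length_map] at h₁
    simp [relabeling, hw.idxOf_getElem i h₁, h₂]

theorem exists_leftInverse_of_nodup_map {f : ℕ → ℕ} {w : List ℕ} (h : (w.map f).Nodup) :
    ∃ g : ℕ → ℕ, ∀ x ∈ w, g (f x) = x := by
  have hf : Set.InjOn f {x | x ∈ w} := fun x hx y hy => List.inj_on_of_nodup_map h hx hy
  exact ⟨Function.invFunOn f {x | x ∈ w}, fun x hx => hf.leftInvOn_invFunOn hx⟩

theorem map_map_of_leftInverse {f g : ℕ → ℕ} {w : List ℕ} (h : ∀ x ∈ w, g (f x) = x) :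
    (w.map f).map g = w := by
  rw [List.map_map]
  conv_rhs => rw [← List.map_id w]
  exact List.map_congr_left h

theorem isPermutation_of_stackSort_eq {w : List ℕ} {n : ℕ} (h : stackSort w = List.range' 1 n) :
    IsPermutation n w :=
  (stackSort_perm w).symm.trans (.of_eq h)

theorem IsPermutation.nodup {w : List ℕ} {n : ℕ} (h : IsPermutation n w) : w.Nodup :=
  h.nodup_iff.2 List.nodup_range'

/-! ### The bijection Φ -/

section Phi

variable {A : List ℕ → List ℕ} {n : ℕ} {θ : List ℕ}

theorem sameShape_map_relabeling {w : List ℕ} (h : stackSort w = List.range' 1 n) :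
    SameShape w (w.map (relabeling w)) := by
  rw [map_relabeling (nodup_of_stackSort_eq h)]
  exact (bijP_spec h).2

theorem sameShape_Phi (hA : IsComposition A) (hθ : θ ∈ sortedBy n (stackSort ∘ A)) :
    SameShape θ (Phi A θ) :=
  (hA.sameShape_and_map hθ.1.nodup (sameShape_map_relabeling hθ.2)).1

theorem apply_Phi (hA : IsComposition A) (hθ : θ ∈ sortedBy n (stackSort ∘ A)) :
    A (Phi A θ) = bijP (A θ) := by
  rw [Phi, (hA.sameShape_and_map hθ.1.nodup (sameShape_map_relabeling hθ.2)).2,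
    map_relabeling (nodup_of_stackSort_eq hθ.2)]

theorem Phi_mem (hA : IsComposition A) (hθ : θ ∈ sortedBy n (stackSort ∘ A)) :
    Phi A θ ∈ sortedBy n (stackSort ∘ reversal ∘ A) := by
  have h : stackSort (A (Phi A θ)).reverse = List.range' 1 n := by
    rw [apply_Phi hA hθ]
    exact (bijP_spec hθ.2).1
  exact ⟨((hA.perm _).symm.trans (List.reverse_perm _).symm).trans
    (isPermutation_of_stackSort_eq h), h⟩

theorem exists_leftInverse_relabeling {w : List ℕ} (h : stackSort w = List.range' 1 n) :
    ∃ g : ℕ → ℕ, ∀ x ∈ w, g (relabeling w x) = x := by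
  apply exists_leftInverse_of_nodup_map
  rw [map_relabeling (nodup_of_stackSort_eq h)]
  exact List.nodup_reverse.1 (nodup_of_stackSort_eq (bijP_spec h).1)

theorem Phi_injOn (hA : IsComposition A) : Set.InjOn (Phi A) (sortedBy n (stackSort ∘ A)) := by
  intro θ hθ η hη h
  -- Since `A` turns Φ into P, injectivity of P shows that both words were relabeled by the same
  -- map.
  have e : A θ = A η := by
    apply bijP_injOn hθ.2 hη.2
    rw [← apply_Phi hA hθ, ← apply_Phi hA hη, h]
  obtain ⟨g, hg⟩ := exists_leftInverse_relabeling hη.2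
  rw [Phi, Phi, e] at h
  have := congrArg (List.map g) h
  rwa [map_map_of_leftInverse, map_map_of_leftInverse] at this
  · exact fun x hx => hg x ((hA.perm η).mem_iff.2 hx)
  · exact fun x hx => hg x (e ▸ (hA.perm θ).mem_iff.2 hx)

theorem Phi_surjOn (hA : IsComposition A) :
    Set.SurjOn (Phi A) (sortedBy n (stackSort ∘ A))
      (sortedBy n (stackSort ∘ reversal ∘ A)) := by
  intro η hη
  obtain ⟨w, hw, e⟩ := exists_bijP_eq (v := A η) hη.2
  have hwn := nodup_of_stackSort_eq hw
  obtain ⟨g, hg⟩ := exists_leftInverse_relabeling hw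
  have e' : w.map (relabeling w) = A η := (map_relabeling hwn).trans e
  have eg : (A η).map g = w := by rw [← e', map_map_of_leftInverse hg]
  -- The inverse relabeling `g` also keeps the shape, so it commutes with `A` and `η.map g` is a
  -- preimage.
  have hs : SameShape (A η) ((A η).map g) := by
    rw [eg, ← e]
    exact (bijP_spec hw).2.symm
  have hAg : A (η.map g) = w := (hA.sameShape_and_map hη.1.nodup hs).2.trans eg
  refine ⟨η.map g, ⟨?_, ?_⟩, ?_⟩
  · exact (hAg ▸ (hA.perm (η.map g)).symm).trans (isPermutation_of_stackSort_eq hw)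
  · change stackSort (A (η.map g)) = _
    rw [hAg, hw]
  · rw [Phi, hAg]
    apply map_map_of_leftInverse
    intro x hx
    have hx' := (hA.perm η).mem_iff.2 hx
    rw [← e'] at hx'
    obtain ⟨z, hz, rfl⟩ := List.mem_map.1 hx'
    rw [hg z hz]

theorem Phi_bijOn (hA : IsComposition A) :
    Set.BijOn (Phi A) (sortedBy n (stackSort ∘ A)) (sortedBy n (stackSort ∘ reversal ∘ A)) :=
  ⟨fun _ hθ => Phi_mem hA hθ, Phi_injOn hA, Phi_surjOn hA⟩

theorem transferred_of_preservedBy (hA : IsComposition A) {T : Type*} {f : List ℕ → T}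
    (h : PreservedBy (Phi A) f (sortedBy n (stackSort ∘ A))) : Transferred n A f := by
  refine ⟨fun v => ?_, h⟩
  have : {θ ∈ sortedBy n (stackSort ∘ reversal ∘ A) | f θ = v} =
      Phi A '' {θ ∈ sortedBy n (stackSort ∘ A) | f θ = v} := by
    ext η
    constructor
    · rintro ⟨hη, hv⟩
      obtain ⟨θ, hθ, rfl⟩ := Phi_surjOn hA hη
      exact ⟨θ, ⟨hθ, (h θ hθ).symm.trans hv⟩, rfl⟩
    · rintro ⟨θ, ⟨hθ, hv⟩, rfl⟩
      exact ⟨Phi_mem hA hθ, (h θ hθ).trans hv⟩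
  rw [this, ((Phi_injOn hA).mono fun θ hθ => hθ.1).ncard_image]

end Phi

/-! ### Statistics determined by the shape -/

section Positions

variable {w w' : List ℕ}

theorem entry_add_one {i : ℕ} (h : i < w.length) : entry w (i + 1) = w[i] := by
  simp [entry, h]

theorem lrMax_iff {i : ℕ} (h : i < w.length) :
    (∀ j < i + 1, 1 ≤ j → entry w j < entry w (i + 1)) ↔ ∀ y ∈ w.take i, y < w[i] := by
  rw [entry_add_one h]
  constructor
  · intro H y hy
    obtain ⟨k, hk, rfl⟩ := List.mem_take_iff_getElem.1 hy
    have := H (k + 1) (by omega) (by omega)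
    rwa [entry_add_one (by omega)] at this
  · intro H j hj hj'
    obtain ⟨k, rfl⟩ := Nat.exists_eq_add_of_le' hj'
    rw [entry_add_one (by omega)]
    exact H _ (List.mem_take_iff_getElem.2 ⟨k, by omega, rfl⟩)

theorem rlMax_iff {i : ℕ} (h : i < w.length) :
    (∀ j ≤ w.length, i + 1 < j → entry w j < entry w (i + 1)) ↔
      ∀ y ∈ w.drop (i + 1), y < w[i] := by
  rw [entry_add_one h]
  constructor
  · intro H y hy
    obtain ⟨k, hk, rfl⟩ := List.mem_drop_iff_getElem.1 hy
    have := H (i + 1 + k + 1) (by omega) (by omega)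
    rwa [entry_add_one (by omega)] at this
  · intro H j hj hj'
    obtain ⟨k, rfl⟩ := Nat.exists_eq_add_of_lt hj'
    rw [entry_add_one (by omega)]
    exact H _ (List.mem_drop_iff_getElem.2 ⟨k, by omega, rfl⟩)

theorem SameShape.lrMaxPositions_eq (h : SameShape w w') :
    lrMaxPositions w = lrMaxPositions w' := by
  unfold lrMaxPositions
  rw [← h.length_eq]
  apply Finset.filter_congr
  intro i hi
  obtain ⟨h₁, h₂⟩ := Finset.mem_Icc.1 hi
  obtain ⟨k, rfl⟩ := Nat.exists_eq_add_of_le' h₁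
  have hk : k < w.length := h₂
  have hk' : k < w'.length := h.length_eq ▸ hk
  rw [lrMax_iff hk, lrMax_iff hk']
  -- A left-to-right maximum is the largest letter of the prefix that it ends.
  apply SameShape.lt_last_iff
  rw [← List.take_succ_eq_append_getElem, ← List.take_succ_eq_append_getElem]
  exact h.take _

theorem SameShape.rlMaxPositions_eq (h : SameShape w w') :
    rlMaxPositions w = rlMaxPositions w' := by
  unfold rlMaxPositions
  rw [← h.length_eq]
  apply Finset.filter_congr
  intro i hi
  obtain ⟨h₁, h₂⟩ := Finset.mem_Icc.1 hi
  obtain ⟨k, rfl⟩ := Nat.exists_eq_add_of_le' h₁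
  have hk : k < w.length := h₂
  have hk' : k < w'.length := h.length_eq ▸ hk
  have := rlMax_iff hk'
  rw [← h.length_eq] at this
  rw [rlMax_iff hk, this]
  apply SameShape.lt_head_iff
  rw [← List.drop_eq_getElem_cons, ← List.drop_eq_getElem_cons]
  exact h.drop _

theorem SameShape.upDownWord_eq (h : SameShape w w') : upDownWord w = upDownWord w' := by
  unfold upDownWord
  rw [← h.length_eq]
  apply List.map_congr_left
  intro i hi
  rw [List.mem_range'_1] at hi
  obtain ⟨k, rfl⟩ := Nat.exists_eq_add_of_le' hi.1
  have hk : k + 1 < w.length := by omega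
  have hk' : k + 1 < w'.length := h.length_eq ▸ hk
  rw [entry_add_one hk, entry_add_one hk', entry_add_one (by omega), entry_add_one (by omega)]
  -- An ascent means that the last letter of a two-letter factor is its largest.
  have hs := (h.drop k).take 2
  rw [List.drop_eq_getElem_cons (by omega), List.drop_eq_getElem_cons hk,
    List.drop_eq_getElem_cons (i := k) (l := w') (by omega), List.drop_eq_getElem_cons hk'] at hs
  have := SameShape.lt_last_iff (u := [w[k]]) (u' := [w'[k]]) (x := w[k + 1]) (x' := w'[k + 1]) hs
  simp only [List.mem_singleton, forall_eq] at this
  simp only [this]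

end Positions

/-! ### The statistics zeil and Rzeil -/

/-- If the largest entries of `w` form a decreasing subword, then `S(w)` ends in these entries. -/
theorem exists_stackSort_eq_append {D w : List ℕ} (hw : w.Nodup) (hD : D.Pairwise (· > ·))
    (hs : D.Sublist w) (hlt : ∀ y ∈ w, y ∉ D → ∀ d ∈ D, y < d) :
    ∃ v, stackSort w = v ++ D.reverse := by
  induction D generalizing w with
  | nil => exact ⟨stackSort w, by simp⟩
  | cons d D ih =>
    rw [List.pairwise_cons] at hD
    obtain ⟨α, β, rfl⟩ := List.append_of_mem (hs.subset List.mem_cons_self)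
    have hd := (List.nodup_cons.1 (List.nodup_middle.1 hw)).1
    have hlt' : ∀ y ∈ α ++ β, y < d := by
      intro y hy
      by_cases hyD : y ∈ D
      · exact hD.1 y hyD
      · refine hlt y (by rw [List.mem_append] at hy ⊢; rw [List.mem_cons]; tauto) ?_ d
          List.mem_cons_self
        rintro (_ | ⟨_, h⟩)
        · exact hd hy
        · exact hyD h
    -- The letter `d` occurs only once, between `α` and `β`, so what follows it in the subword lies
    -- in `β`.
    have hsβ : D.Sublist β := by
      obtain ⟨l₁, l₂, e, h₁, h₂⟩ := List.sublist_append_iff.1 hs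
      cases l₁ with
      | nil =>
        rw [List.nil_append] at e
        exact List.cons_sublist_cons.1 (e ▸ h₂)
      | cons x l₁ =>
        rw [List.cons_append] at e
        obtain ⟨rfl, -⟩ := List.cons.inj e
        exact absurd (List.mem_append_left β (h₁.subset List.mem_cons_self)) hd
    obtain ⟨v, hv⟩ := ih hw.of_append_right.of_cons hD.2 hsβ fun y hy hyD x hx =>
      hlt y (by simp [hy]) (by
        rintro (_ | ⟨_, h⟩)
        · exact hd (by simp [hy])
        · exact hyD h) x (by simp [hx])
    refine ⟨stackSort α ++ v, ?_⟩
    rw [stackSort_node (fun y hy => hlt' y (by simp [hy])) (fun y hy => hlt' y (by simp [hy])), hv]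
    simp

/-- Stack-sorting keeps increasing subwords. -/
theorem sublist_stackSort {l w : List ℕ} (hw : w.Nodup) (hl : l.Pairwise (· < ·))
    (hs : l.Sublist w) : l.Sublist (stackSort w) := by
  induction w, hw using node_induction generalizing l with
  | nil => simpa [stackSort_nil] using hs
  | node α m β hn hα hβ ih₁ ih₂ =>
    rw [stackSort_node hα hβ]
    obtain ⟨l₁, l₂, rfl, h₁, h₂⟩ := List.sublist_append_iff.1 hs
    rw [List.pairwise_append] at hl
    rw [List.append_assoc]
    refine (ih₁ hl.1 h₁).append ?_
    rcases List.sublist_cons_iff.1 h₂ with h | ⟨r, rfl, h⟩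
    · exact (ih₂ hl.2.1 h).trans (List.sublist_append_left _ _)
    · have : r = [] := by
        refine List.eq_nil_iff_forall_not_mem.2 fun y hy => ?_
        have a₁ := (List.pairwise_cons.1 hl.2.1).1 y hy
        have a₂ := hβ y (h.subset hy)
        omega
      rw [this]
      exact List.sublist_append_right _ _

theorem iterate_stackSort_perm (k : ℕ) (w : List ℕ) : (stackSort^[k] w).Perm w := by
  induction k with
  | zero => exact .rfl
  | succ k ih =>
    rw [Function.iterate_succ_apply']
    exact (stackSort_perm _).trans ih

theorem sublist_iterate_stackSort {l w : List ℕ} (hw : w.Nodup) (hl : l.Pairwise (· < ·))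
    (hs : l.Sublist w) (k : ℕ) : l.Sublist (stackSort^[k] w) := by
  induction k with
  | zero => exact hs
  | succ k ih =>
    rw [Function.iterate_succ_apply']
    exact sublist_stackSort ((iterate_stackSort_perm k w).nodup_iff.2 hw) hl ih

/-- If a permutation of `[p + k]` ends in `p + 1, …, p + k`, then so does every permutation of the
same shape. -/
theorem SameShape.exists_eq_append {p k : ℕ} {v w' : List ℕ}
    (h : SameShape (v ++ List.range' (p + 1) k) w')
    (hw : (v ++ List.range' (p + 1) k).Perm (List.range' 1 (p + k)))
    (hw' : w'.Perm (List.range' 1 (p + k))) : ∃ v', w' = v' ++ List.range' (p + 1) k := by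
  induction k generalizing w' with
  | zero => exact ⟨w', by simp⟩
  | succ k ih =>
    rw [List.range'_concat, ← List.append_assoc] at h hw
    rw [← add_assoc, List.range'_concat] at hw hw'
    have e₁ : p + 1 + 1 * k = p + k + 1 := by ring
    have e₂ : 1 + 1 * (p + k) = p + k + 1 := by ring
    rw [e₁] at h hw
    rw [e₂] at hw hw'
    have hp := (List.perm_append_right_iff _).1 hw
    have hlt : ∀ y ∈ v ++ List.range' (p + 1) k, y < p + k + 1 := by
      intro y hy
      have := hp.mem_iff.1 hy
      rw [List.mem_range'_1] at this
      omega
    rcases List.eq_nil_or_concat' w' with rfl | ⟨u', x', rfl⟩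
    · simpa using h.length_eq
    have hlt' := h.lt_last hlt
    -- By shape the last entry of `w'` is its largest, and `w'` is a permutation of `[p + k + 1]`.
    obtain rfl : x' = p + k + 1 := by
      have a₁ : x' ≤ p + k + 1 := by
        have := (hw'.mem_iff (a := x')).1 (by simp)
        rw [List.mem_append, List.mem_range'_1, List.mem_singleton] at this
        omega
      have a₂ := (hw'.mem_iff (a := p + k + 1)).2 (by simp)
      rcases List.mem_append.1 a₂ with a | a
      · exact absurd (hlt' _ a) (by omega)
      · exact (List.mem_singleton.1 a).symm
    obtain ⟨v', rfl⟩ := ih (h.of_append (by simpa [← add_assoc] using h.length_eq)).1 hp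
      ((List.perm_append_right_iff _).1 hw')
    refine ⟨v', ?_⟩
    rw [List.range'_concat, e₁, List.append_assoc]

/-- A relabeling that preserves the shape of `S(w)` fixes the largest entries of the permutation
`w` if these form a decreasing subword. -/
theorem map_range'_eq_of_sublist {n k : ℕ} {w : List ℕ} {f : ℕ → ℕ} (hk : k ≤ n)
    (hw : IsPermutation n w) (hf : IsPermutation n (w.map f))
    (hs : (List.range' (n - k + 1) k).reverse.Sublist w)
    (h : SameShape (stackSort w) ((stackSort w).map f)) :
    (List.range' (n - k + 1) k).map f = List.range' (n - k + 1) k := by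
  obtain ⟨p, rfl⟩ := Nat.exists_eq_add_of_le' hk
  rw [Nat.add_sub_cancel] at hs ⊢
  obtain ⟨v, hv⟩ := exists_stackSort_eq_append hw.nodup
    (List.pairwise_reverse.2 List.pairwise_lt_range') hs (by
      intro y hy hyD d hd
      have := hw.mem_iff.1 hy
      rw [List.mem_reverse, List.mem_range'_1] at hyD hd
      rw [List.mem_range'_1] at this
      omega)
  rw [List.reverse_reverse] at hv
  rw [hv] at h
  obtain ⟨v', hv'⟩ := h.exists_eq_append (hv ▸ (stackSort_perm w).trans hw)
    (hv ▸ ((stackSort_perm w).map f).trans hf)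
  rw [List.map_append] at hv'
  exact (List.append_inj' hv' (by simp)).2

theorem zeil_le_zeil {w w' : List ℕ} (hl : w.length = w'.length)
    (h : ∀ k ≤ w.length, (List.range' (w.length - k + 1) k).reverse.Sublist w →
      (List.range' (w.length - k + 1) k).reverse.Sublist w') : zeil w ≤ zeil w' := by
  unfold zeil
  rw [← hl]
  refine Nat.le_findGreatest (Nat.findGreatest_le _) (h _ (Nat.findGreatest_le _) ?_)
  exact Nat.findGreatest_spec (P := fun k => (List.range' (w.length - k + 1) k).reverse.Sublist w)
    (Nat.zero_le _) (by simp)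

theorem Rzeil_le_Rzeil {w w' : List ℕ} (hl : w.length = w'.length)
    (h : ∀ k ≤ w.length, (List.range' (w.length - k + 1) k).Sublist w →
      (List.range' (w.length - k + 1) k).Sublist w') : Rzeil w ≤ Rzeil w' := by
  unfold Rzeil
  rw [← hl]
  refine Nat.le_findGreatest (Nat.findGreatest_le _) (h _ (Nat.findGreatest_le _) ?_)
  exact Nat.findGreatest_spec (P := fun k => (List.range' (w.length - k + 1) k).Sublist w)
    (Nat.zero_le _) (by simp)

section Zeil

variable {n : ℕ} {θ : List ℕ} {f : ℕ → ℕ}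

theorem IsPermutation.length_eq (h : IsPermutation n θ) : θ.length = n := by
  simpa using List.Perm.length_eq h

theorem zeil_le_zeil_map (hθ : IsPermutation n θ) (hf : IsPermutation n (θ.map f))
    (h : SameShape (stackSort θ) ((stackSort θ).map f)) : zeil θ ≤ zeil (θ.map f) := by
  apply zeil_le_zeil (by simp)
  rw [hθ.length_eq]
  intro k hk hs
  have := hs.map f
  rwa [List.map_reverse, map_range'_eq_of_sublist hk hθ hf hs h] at this

/-- The iterate keeps the increasing subword and the reversal makes it decreasing, so the argument
for zeil, applied to the reversed iterate, shows that `f` fixes its entries. -/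
theorem Rzeil_le_Rzeil_map {k : ℕ} (hθ : IsPermutation n θ) (hf : IsPermutation n (θ.map f))
    (h : SameShape (stackSort (stackSort^[k] θ).reverse)
      ((stackSort (stackSort^[k] θ).reverse).map f)) : Rzeil θ ≤ Rzeil (θ.map f) := by
  apply Rzeil_le_Rzeil (by simp)
  rw [hθ.length_eq]
  intro j hj hs
  have hp : (stackSort^[k] θ).reverse.Perm θ :=
    (List.reverse_perm _).trans (iterate_stackSort_perm k θ)
  have hs' := (sublist_iterate_stackSort hθ.nodup List.pairwise_lt_range' hs k).reverse
  have := hs.map f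
  rwa [map_range'_eq_of_sublist hj (hp.trans hθ) ((hp.map f).trans hf) hs' h] at this

theorem isComposition_iterate (k : ℕ) : IsComposition stackSort^[k] := by
  induction k with
  | zero => exact .identity
  | succ k ih =>
    rw [Function.iterate_succ']
    exact .stackSort_comp ih

/-- A statistic that does not decrease under the relabelings that preserve the shape of `B(θ)` is
invariant under the maps `Φ_{A ∘ B}`. -/
theorem preservedBy_of_le_map {A B : List ℕ → List ℕ} (hA : IsComposition A)
    (hB : IsComposition B) {s : List ℕ → ℕ}
    (hs : ∀ (θ : List ℕ) (f : ℕ → ℕ), IsPermutation n θ → IsPermutation n (θ.map f) →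
      SameShape (B θ) ((B θ).map f) → s θ ≤ s (θ.map f))
    (hAB : IsComposition (A ∘ B)) :
    PreservedBy (Phi (A ∘ B)) s (sortedBy n (stackSort ∘ A ∘ B)) := by
  intro θ hθ
  have hθ' := (Phi_mem hAB hθ).1
  have hn : (B θ).Nodup := (hB.perm θ).nodup_iff.2 hθ.1.nodup
  have hS : SameShape (B θ) ((B θ).map (relabeling ((A ∘ B) θ))) :=
    (hA.sameShape_and_map hn (sameShape_map_relabeling hθ.2)).1
  obtain ⟨g, hg⟩ := exists_leftInverse_relabeling hθ.2
  have hgθ : ∀ x ∈ θ, g (relabeling ((A ∘ B) θ) x) = x :=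
    fun x hx => hg x ((hAB.perm θ).mem_iff.2 hx)
  have e : (Phi (A ∘ B) θ).map g = θ := map_map_of_leftInverse hgθ
  have eB : B (Phi (A ∘ B) θ) = (B θ).map (relabeling ((A ∘ B) θ)) :=
    (hB.sameShape_and_map hθ.1.nodup hS).2
  -- Monotonicity is used twice: for the relabeling itself and for its inverse `g`, which takes the
  -- image back to `θ`.
  apply le_antisymm
  · have := hs (Phi (A ∘ B) θ) g hθ' (by rw [e]; exact hθ.1) (by
      rw [eB, map_map_of_leftInverse fun x hx => hgθ x ((hB.perm θ).mem_iff.1 hx)]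
      exact hS.symm)
    rwa [e] at this
  · exact hs θ _ hθ.1 hθ' hS

end Zeil

end StackSorting

theorem mainTheorem1 (A : List ℕ → List ℕ) (hA : StackSorting.IsComposition A) (n : ℕ) :
    (StackSorting.sortedBy n (StackSorting.stackSort ∘ A)).ncard =
        (StackSorting.sortedBy n
          (StackSorting.stackSort ∘ StackSorting.reversal ∘ A)).ncard ∧
      Set.BijOn (StackSorting.Phi A)
        (StackSorting.sortedBy n (StackSorting.stackSort ∘ A))
        (StackSorting.sortedBy n (StackSorting.stackSort ∘ StackSorting.reversal ∘ A)) ∧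
      StackSorting.Transferred n A StackSorting.rlMaxCount ∧
      StackSorting.Transferred n A StackSorting.rlMaxPositions ∧
      StackSorting.Transferred n A StackSorting.lrMaxCount ∧
      StackSorting.Transferred n A StackSorting.lrMaxPositions ∧
      StackSorting.Transferred n A StackSorting.upDownWord ∧
      (∀ (T : Type*) (f : List ℕ → T),
        (∀ σ τ : List ℕ, StackSorting.IsPermutation n σ → StackSorting.IsPermutation n τ →
          StackSorting.upDownWord σ = StackSorting.upDownWord τ → f σ = f τ) →
        StackSorting.Transferred n A f) ∧
      (∀ A₀ : List ℕ → List ℕ, StackSorting.IsComposition A₀ →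
        A = A₀ ∘ StackSorting.stackSort →
        StackSorting.Transferred n A StackSorting.zeil) ∧
      (∀ (B₀ : List ℕ → List ℕ) (k : ℕ), StackSorting.IsComposition B₀ → 1 ≤ k →
        A = B₀ ∘ StackSorting.stackSort ∘ StackSorting.reversal ∘ StackSorting.stackSort^[k] →
        StackSorting.Transferred n A StackSorting.Rzeil) := by
  open StackSorting in
  have hbij := Phi_bijOn (n := n) hA
  have hshape : ∀ θ ∈ sortedBy n (stackSort ∘ A), SameShape (Phi A θ) θ :=
    fun θ hθ => (sameShape_Phi hA hθ).symm
  have hcard := hbij.injOn.ncard_image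
  rw [hbij.image_eq] at hcard
  refine ⟨hcard.symm, hbij, ?_, ?_, ?_, ?_, ?_, ?_, ?_, ?_⟩
  · exact transferred_of_preservedBy hA fun θ hθ =>
      congrArg Finset.card (hshape θ hθ).rlMaxPositions_eq
  · exact transferred_of_preservedBy hA fun θ hθ => (hshape θ hθ).rlMaxPositions_eq
  · exact transferred_of_preservedBy hA fun θ hθ =>
      congrArg Finset.card (hshape θ hθ).lrMaxPositions_eq
  · exact transferred_of_preservedBy hA fun θ hθ => (hshape θ hθ).lrMaxPositions_eq
  · exact transferred_of_preservedBy hA fun θ hθ => (hshape θ hθ).upDownWord_eq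
  · exact fun T f hf => transferred_of_preservedBy hA fun θ hθ =>
      hf _ _ (Phi_mem hA hθ).1 hθ.1 (hshape θ hθ).upDownWord_eq
  · rintro A₀ hA₀ rfl
    exact transferred_of_preservedBy hA (preservedBy_of_le_map hA₀ (.stackSort_comp .identity)
      (fun θ f hθ hf h => zeil_le_zeil_map hθ hf h) hA)
  · rintro B₀ k hB₀ - rfl
    exact transferred_of_preservedBy hA (preservedBy_of_le_map hB₀
      (.stackSort_comp (.reversal_comp (isComposition_iterate k)))
      (fun θ f hθ hf h => Rzeil_le_Rzeil_map hθ hf h) hA)
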